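/- Let $n$ be a positive integer and let $G_n$ be the straight linear 2-tree on $n$ vertices: the graph with vertex set $\{1,\dots,n\}$ in which $i$ and $j$ are adjacent if and only if $1\le |i-j|\le 2$. Regard every edge of $G_n$ as a unit resistor, and write $r(i,j)$ for the resistance distance between $i$ and $j$ (with $m=n-2$ this is often written $r_m(i,j)$), that is, $r(i,j)=v_i-v_j$ for any $v\in\mathbb{R}^n$ with $L(G_n)v=e_i-e_j$, where $L(G_n)$ is the Laplacian matrix. **Theorem.** 1. For every integer $k\ge 2$ and all $j,\ell$ with $1\le j<j+k\le n$ and $1\le \ell<\ell+k+1\le n$, $$ r(j,j+k)<r(\ell,\ell+k+1). $$ 2. Consequently the non-edges of $G_n$ are ordered exactly by resistance distance: first by index distance and, at equal index distance, from the centre outwards, ties occurring only between mirror images. That is, for any two non-edges $\{a,b\}$, $\{c,d\}$ of $G_n$ with $a<b$ and $c<d$, $$ r(a,b)<r(c,d)\iff b-a<d-c\ \text{ or }\ \bigl(b-a=d-c \text{ and } |a+b-(n+1)|<|c+d-(n+1)|\bigr), $$ and $r(a,b)=r(c,d)$ if and only if $\{c,d\}=\{a,b\}$ or $\{c,d\}=\{n+1-b,\,n+1-a\}$.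 -/

import Mathlib

open scoped Matrix

/-- The straight linear 2-tree on `n` vertices. The vertices, labelled `1, …, n` in the usual
picture, are the elements of `Fin n`; the element with value `i` carries the label `i + 1`.
The adjacency matrix has ones exactly on the first and second sub- and superdiagonals. -/
def straightLinearTwoTree (n : ℕ) : SimpleGraph (Fin n) where
  Adj i j := (j : ℕ) = i + 1 ∨ (j : ℕ) = i + 2 ∨ (i : ℕ) = j + 1 ∨ (i : ℕ) = j + 2
  symm := ⟨fun i j h => by omega⟩
  loopless := ⟨fun i h => by omega⟩

instance (n : ℕ) : DecidableRel (straightLinearTwoTree n).Adj := fun i j =>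
  inferInstanceAs (Decidable
    ((j : ℕ) = i + 1 ∨ (j : ℕ) = i + 2 ∨ (i : ℕ) = j + 1 ∨ (i : ℕ) = j + 2))

section Resistance

variable {V : Type*} [Fintype V] [DecidableEq V]

/-- `v` is a vector of node potentials for which, when every edge of `G` is a unit resistor, one
unit of current enters the circuit at `i` and leaves it at `j`: the Laplacian system
`L(G) v = e_i - e_j` (Kirchhoff's current law together with Ohm's law). -/
def IsUnitFlowPotential (G : SimpleGraph V) [DecidableRel G.Adj] (i j : V) (v : V → ℝ) : Prop :=
  G.lapMatrix ℝ *ᵥ v = Pi.single i 1 - Pi.single j 1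

open Classical in
/-- The resistance distance (effective resistance) between `i` and `j` in `G`, every edge being a
unit resistor: the potential difference `v i - v j` needed to drive one unit of current from `i`
to `j`. The value does not depend on the potential `v` (`resistanceDistance_eq`), and in a
connected graph such a `v` always exists (`exists_isUnitFlowPotential`). -/
noncomputable def resistanceDistance (G : SimpleGraph V) [DecidableRel G.Adj] (i j : V) : ℝ :=
  if h : ∃ v : V → ℝ, IsUnitFlowPotential G i j v then h.choose i - h.choose j else 0

theorem IsUnitFlowPotential.sub_eq_sub {G : SimpleGraph V} [DecidableRel G.Adj] {i j : V}
    {v w : V → ℝ} (hv : IsUnitFlowPotential G i j v) (hw : IsUnitFlowPotential G i j w) :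
    v i - v j = w i - w j := by
  have key : ∀ x y : V → ℝ, x ⬝ᵥ (G.lapMatrix ℝ *ᵥ y) = y ⬝ᵥ (G.lapMatrix ℝ *ᵥ x) := by
    intro x y
    rw [Matrix.dotProduct_mulVec, ← Matrix.mulVec_transpose, (G.isSymm_lapMatrix (R := ℝ)).eq,
      dotProduct_comm]
  have h := key v w
  unfold IsUnitFlowPotential at hv hw
  rw [hv, hw] at h
  simpa [dotProduct_sub] using h

theorem resistanceDistance_eq {G : SimpleGraph V} [DecidableRel G.Adj] {i j : V} {v : V → ℝ}
    (hv : IsUnitFlowPotential G i j v) : resistanceDistance G i j = v i - v j := by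
  have h : ∃ v : V → ℝ, IsUnitFlowPotential G i j v := ⟨v, hv⟩
  rw [resistanceDistance, dif_pos h]
  exact h.choose_spec.sub_eq_sub hv

theorem exists_isUnitFlowPotential {G : SimpleGraph V} [DecidableRel G.Adj] (hG : G.Connected)
    (i j : V) : ∃ v : V → ℝ, IsUnitFlowPotential G i j v := by
  -- `L + J` is invertible, where `J` is the all-ones matrix
  let f : (V → ℝ) →ₗ[ℝ] (V → ℝ) :=
    (G.lapMatrix ℝ).mulVecLin + LinearMap.pi fun _ => ∑ a, LinearMap.proj a
  have hf : ∀ x, f x = G.lapMatrix ℝ *ᵥ x + fun _ => ∑ a, x a := by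
    intro x; ext b; simp [f]
  have hsum : ∀ x : V → ℝ, ∑ b, (G.lapMatrix ℝ *ᵥ x) b = 0 := by
    intro x
    have h1 : (fun _ => (1 : ℝ)) ⬝ᵥ (G.lapMatrix ℝ *ᵥ x) = 0 := by
      rw [Matrix.dotProduct_mulVec, ← Matrix.mulVec_transpose, (G.isSymm_lapMatrix (R := ℝ)).eq,
        G.lapMatrix_mulVec_const_eq_zero, zero_dotProduct]
    simpa [dotProduct] using h1
  have : Nonempty V := hG.nonempty
  have hcard : (Fintype.card V : ℝ) ≠ 0 := by exact_mod_cast Fintype.card_ne_zero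
  have hs : ∀ x, ∑ b, f x b = Fintype.card V * ∑ a, x a := by
    intro x; rw [hf]; simp [Finset.sum_add_distrib, hsum]
  have hinj : Function.Injective f := by
    rw [← LinearMap.ker_eq_bot, LinearMap.ker_eq_bot']
    intro x hx
    have h0 : ∑ a, x a = 0 := by
      have := hs x
      rw [hx] at this
      simpa [hcard] using this.symm
    have hL : G.lapMatrix ℝ *ᵥ x = 0 := by
      have := hf x
      rw [hx, h0] at this
      ext b
      simpa using (congrFun this b).symm
    rw [G.lapMatrix_mulVec_eq_zero_iff_forall_reachable] at hL
    ext b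
    have h2 : ∑ a, x a = Fintype.card V * x b := by
      rw [Finset.sum_congr rfl fun a _ => hL a b (hG.preconnected a b)]; simp
    rw [h0] at h2
    simpa [hcard] using h2.symm
  obtain ⟨v, hv⟩ := LinearMap.injective_iff_surjective.mp hinj (Pi.single i 1 - Pi.single j 1)
  have h0 : ∑ a, v a = 0 := by
    have := hs v
    rw [hv] at this
    simpa [Finset.sum_sub_distrib, hcard] using this.symm
  refine ⟨v, ?_⟩
  have h := hf v
  rw [hv, h0] at h
  unfold IsUnitFlowPotential
  rw [h]; ext b; simp

end Resistance

theorem straightLinearTwoTree_connected (n : ℕ) (hn : 0 < n) :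
    (straightLinearTwoTree n).Connected := by
  have : Nonempty (Fin n) := ⟨⟨0, hn⟩⟩
  have h : ∀ (a : ℕ) (ha : a < n), (straightLinearTwoTree n).Reachable ⟨0, hn⟩ ⟨a, ha⟩ := by
    intro a
    induction a with
    | zero => intro _; exact SimpleGraph.Reachable.refl _
    | succ a ih =>
      intro ha
      exact (ih (by omega)).trans (SimpleGraph.Adj.reachable (Or.inl rfl))
  exact ⟨fun a b => (h a a.2).symm.trans (h b b.2)⟩

/-! Put the vertices at `0, …, N` with `N = n - 1`. On `ℤ` the Laplacian has characteristic
polynomial `-(z - 1)² (z² + 3z + 1) / z²`, so its kernel is spanned by `1`, `x`, `(-1)^x cosh (θx)`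
and `(-1)^x sinh (θx)`. A Green function with pole `y` is glued from a left branch and its mirror
image, each combining a linear term with an alternating hyperbolic cosine centred at its end.
Cutting the line down to the segment leaves a boundary charge that does not depend on `y`, so the
difference of two Green functions solves the unit-flow system.

Writing `h` for `halfLucas` and `W` for the Wronskian, this gives, for `b = a + k`, `r(a,b) = k/5 +
(h(N) - (-1)^k h(N-k) + h(a+b-N) (h(k) - (-1)^k)) / (5W)`. For fixed `k > 0` this increases with
`|a+b-N|`, as `cosh` does. From `k` to `k + 1`, the gain `1/5` outweighs the loss even when the
shorter pair is at an end and the longer one is central (`resistance_increment_pos`). -/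

/-! ### Hyperbolic cosines and the alternating solution -/

/-- The positive real `θ` with `2 cosh θ = 3`, so that `exp θ` is the square of the golden ratio. -/
noncomputable def latticeRate : ℝ := Real.arsinh (√5 / 2)

theorem cosh_latticeRate : Real.cosh latticeRate = 3 / 2 := by
  rw [latticeRate, Real.cosh_arsinh, div_pow, Real.sq_sqrt (by norm_num),
    show (1 : ℝ) + 5 / 2 ^ 2 = (3 / 2) ^ 2 by norm_num, Real.sqrt_sq (by norm_num)]

theorem latticeRate_pos : 0 < latticeRate := by
  rw [latticeRate, Real.arsinh_pos_iff]; positivity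

/-- Half the Lucas number with index `2 * m`. -/
noncomputable def halfLucas (m : ℤ) : ℝ := Real.cosh (m * latticeRate)

theorem halfLucas_neg (m : ℤ) : halfLucas (-m) = halfLucas m := by
  simp [halfLucas, Real.cosh_neg]

theorem halfLucas_zero : halfLucas 0 = 1 := by simp [halfLucas]

theorem halfLucas_one : halfLucas 1 = 3 / 2 := by simp [halfLucas, cosh_latticeRate]

theorem one_le_halfLucas (m : ℤ) : 1 ≤ halfLucas m := Real.one_le_cosh _

theorem halfLucas_mul (x y : ℤ) :
    2 * (halfLucas x * halfLucas y) = halfLucas (x + y) + halfLucas (x - y) := by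
  simp only [halfLucas, Int.cast_add, Int.cast_sub, add_mul, sub_mul, Real.cosh_add, Real.cosh_sub]
  ring

theorem halfLucas_add_one (x : ℤ) : halfLucas (x + 1) = 3 * halfLucas x - halfLucas (x - 1) := by
  have := halfLucas_mul x 1
  rw [halfLucas_one] at this
  linarith

theorem halfLucas_lt_iff {x y : ℤ} : halfLucas x < halfLucas y ↔ |x| < |y| := by
  rw [halfLucas, halfLucas, Real.cosh_lt_cosh, abs_mul, abs_mul,
    mul_lt_mul_iff_left₀ (abs_pos.2 latticeRate_pos.ne')]
  exact_mod_cast Iff.rfl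

theorem halfLucas_le_iff {x y : ℤ} : halfLucas x ≤ halfLucas y ↔ |x| ≤ |y| := by
  rw [← not_lt, halfLucas_lt_iff, not_lt]

/-- The Wronskian of the two boundary solutions `halfLucas x` and `halfLucas (N - x)`. -/
noncomputable def boundaryWronskian (N : ℤ) : ℝ := (halfLucas (N + 1) - halfLucas (N - 1)) / 2

theorem boundaryWronskian_pos {N : ℤ} (hN : 0 < N) : 0 < boundaryWronskian N := by
  have : halfLucas (N - 1) < halfLucas (N + 1) := by
    rw [halfLucas_lt_iff, abs_of_nonneg (by omega), abs_of_nonneg (by omega)]; omega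
  rw [boundaryWronskian]; linarith

/-- Both products expand with the same term `halfLucas (2 * y + 1 - N)`, which cancels, so nothing
depends on `y`. This identity fixes the coefficient in `greenLeft`. -/
theorem boundaryWronskian_eq (N y : ℤ) :
    halfLucas (y + 1) * halfLucas (N - y) - halfLucas y * halfLucas (N - (y + 1)) =
      boundaryWronskian N := by
  have h1 := halfLucas_mul (y + 1) (N - y)
  have h2 := halfLucas_mul y (N - (y + 1))
  rw [show y + 1 + (N - y) = N + 1 by ring, show y + 1 - (N - y) = 2 * y + 1 - N by ring] at h1
  rw [show y + (N - (y + 1)) = N - 1 by ring, show y - (N - (y + 1)) = 2 * y + 1 - N by ring] at h2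
  rw [boundaryWronskian]; linarith

/-- The homogeneous solution satisfying the left boundary conditions. -/
noncomputable def alternatingLucas (x : ℤ) : ℝ := (-1) ^ x * halfLucas x

theorem neg_one_zpow_add_one (x : ℤ) : (-1 : ℝ) ^ (x + 1) = -(-1) ^ x := by
  rw [zpow_add₀ (by norm_num)]; simp

theorem neg_one_zpow_mul_self (x : ℤ) : (-1 : ℝ) ^ x * (-1) ^ x = 1 := by
  rw [← mul_zpow]; simp

theorem alternatingLucas_add_one (x : ℤ) :
    alternatingLucas (x + 1) = -3 * alternatingLucas x - alternatingLucas (x - 1) := by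
  have h : (-1 : ℝ) ^ x = -(-1) ^ (x - 1) := by
    rw [← neg_one_zpow_add_one, sub_add_cancel]
  simp only [alternatingLucas]
  rw [halfLucas_add_one, neg_one_zpow_add_one, h]; ring

theorem alternatingLucas_sub (N x : ℤ) :
    alternatingLucas (N - x) = (-1) ^ N * ((-1) ^ x * halfLucas (N - x)) := by
  rw [alternatingLucas, sub_eq_add_neg, zpow_add₀ (by norm_num), zpow_neg, ← inv_zpow, inv_neg,
    inv_one]
  ring

theorem alternatingLucas_neg (x : ℤ) : alternatingLucas (-x) = alternatingLucas x := by
  rw [alternatingLucas, alternatingLucas, halfLucas_neg, zpow_neg, ← inv_zpow, inv_neg, inv_one]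

theorem alternatingLucas_zero : alternatingLucas 0 = 1 := by
  simp [alternatingLucas, halfLucas_zero]

theorem alternatingLucas_one : alternatingLucas 1 = -(3 / 2) := by
  simp [alternatingLucas, halfLucas_one]

theorem alternatingLucas_two : alternatingLucas 2 = 7 / 2 := by
  have := alternatingLucas_add_one 1
  norm_num [alternatingLucas_one, alternatingLucas_zero] at this ⊢
  linarith

/-! ### The Green function -/

/-- The Laplacian of the infinite graph on `ℤ` with edges between integers at distance 1 or 2. -/
def lineLaplacian (v : ℤ → ℝ) (x : ℤ) : ℝ :=
  (v x - v (x - 1)) + (v x - v (x - 2)) + (v x - v (x + 1)) + (v x - v (x + 2))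

/-- Left branch of the Green function with pole `y` on the segment `[0, N]`. -/
noncomputable def greenLeft (N y x : ℤ) : ℝ :=
  ((x : ℝ) - y) / 10 +
    (-1) ^ y * halfLucas (N - y) / (5 * boundaryWronskian N) * alternatingLucas x

/-- The Green function on the segment `[0, N]`, up to a charge independent of the pole `y`. -/
noncomputable def green (N y x : ℤ) : ℝ :=
  if x ≤ y then greenLeft N y x else greenLeft N (N - y) (N - x)

theorem lineLaplacian_greenLeft (N y x : ℤ) : lineLaplacian (greenLeft N y) x = 0 := by
  have h1 := alternatingLucas_add_one x
  have h2 := alternatingLucas_add_one (x + 1)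
  have h3 := alternatingLucas_add_one (x - 1)
  rw [show x + 1 + 1 = x + 2 by ring, add_sub_cancel_right] at h2
  rw [show x - 1 - 1 = x - 2 by ring, sub_add_cancel] at h3
  have h4 : alternatingLucas (x - 2) = -3 * alternatingLucas (x - 1) - alternatingLucas x := by
    linarith
  simp only [lineLaplacian, greenLeft]
  rw [h4, h2, h1]
  push_cast
  ring

/-- The alternating term contributes nothing, since `2 + 3/2 - 7/2 = 0`; only the slope `1/10` is
felt. At vertex 1 evenness of `alternatingLucas` plays the same role. The charges `3/10 + 1/5` make
up the half unit of current reaching each end. -/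
theorem greenLeft_boundary_zero (N y : ℤ) :
    (greenLeft N y 0 - greenLeft N y (-1)) + (greenLeft N y 0 - greenLeft N y (-2)) = 3 / 10 := by
  simp only [greenLeft, alternatingLucas_neg, alternatingLucas_zero, alternatingLucas_one,
    alternatingLucas_two]
  push_cast
  ring

theorem greenLeft_boundary_one (N y : ℤ) : greenLeft N y 1 - greenLeft N y (-1) = 1 / 5 := by
  simp only [greenLeft, alternatingLucas_neg]
  push_cast
  ring

theorem greenLeft_reflect_self (N y : ℤ) : greenLeft N (N - y) (N - y) = greenLeft N y y := by
  simp only [greenLeft, alternatingLucas]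
  rw [sub_sub_cancel]
  linear_combination halfLucas y * halfLucas (N - y) / (5 * boundaryWronskian N) *
    (neg_one_zpow_mul_self (N - y) - neg_one_zpow_mul_self y)

/-- The linear terms of the two branches differ by `1/5` at `y + 1`, and the Wronskian normalisation
makes the alternating terms compensate. The branches thus agree on `y - 1`, `y`, `y + 1`, so either
formula may be used there. -/
theorem greenLeft_reflect_add_one {N : ℤ} (hN : 0 < N) (y : ℤ) :
    greenLeft N (N - y) (N - (y + 1)) = greenLeft N y (y + 1) := by
  have hW := (boundaryWronskian_pos hN).ne'
  have h := boundaryWronskian_eq N y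
  have e1 : (-1 : ℝ) ^ (N - y) = -(-1) ^ (N - (y + 1)) := by
    rw [← neg_one_zpow_add_one]; congr 1; ring
  simp only [greenLeft, alternatingLucas]
  rw [sub_sub_cancel, e1, neg_one_zpow_add_one]
  have h1 := neg_one_zpow_mul_self (N - (y + 1))
  have h2 := neg_one_zpow_mul_self y
  push_cast
  field_simp
  linear_combination 10 * h - 10 * halfLucas y * halfLucas (N - (y + 1)) * h1 +
    10 * halfLucas (y + 1) * halfLucas (N - y) * h2

theorem greenLeft_reflect_sub_one {N : ℤ} (hN : 0 < N) (y : ℤ) :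
    greenLeft N (N - y) (N - (y - 1)) = greenLeft N y (y - 1) := by
  have := greenLeft_reflect_add_one hN (N - y)
  rw [sub_sub_cancel] at this
  rw [show y - 1 = N - (N - y + 1) by ring, this]
  congr 1; ring

theorem green_eq_left {N : ℤ} (hN : 0 < N) {y x : ℤ} (h : x ≤ y + 1) :
    green N y x = greenLeft N y x := by
  rw [green]
  split_ifs with hx
  · rfl
  · obtain rfl : x = y + 1 := by omega
    exact greenLeft_reflect_add_one hN y

theorem green_eq_right {N : ℤ} (hN : 0 < N) {y x : ℤ} (h : y - 1 ≤ x) :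
    green N y x = greenLeft N (N - y) (N - x) := by
  rw [green]
  split_ifs with hx
  · obtain rfl | rfl : x = y ∨ x = y - 1 := by omega
    · exact (greenLeft_reflect_self N x).symm
    · exact (greenLeft_reflect_sub_one hN y).symm
  · rfl

theorem green_reflect {N : ℤ} (hN : 0 < N) (y x : ℤ) :
    green N (N - y) (N - x) = green N y x := by
  rcases le_total x y with h | h
  · rw [green_eq_left hN (by omega : x ≤ y + 1), green_eq_right hN (by omega)]
    simp
  · rw [green_eq_right hN (by omega : y - 1 ≤ x), green_eq_left hN (by omega)]

theorem lineLaplacian_green_of_lt {N : ℤ} (hN : 0 < N) {y x : ℤ} (h : x < y) :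
    lineLaplacian (green N y) x = 0 := by
  rw [← lineLaplacian_greenLeft N y x]
  simp only [lineLaplacian]
  rw [green_eq_left hN, green_eq_left hN, green_eq_left hN, green_eq_left hN, green_eq_left hN] <;>
    omega

theorem lineLaplacian_green_reflect {N : ℤ} (hN : 0 < N) (y x : ℤ) :
    lineLaplacian (green N (N - y)) (N - x) = lineLaplacian (green N y) x := by
  simp only [lineLaplacian]
  rw [show N - x - 1 = N - (x + 1) by ring, show N - x - 2 = N - (x + 2) by ring,
    show N - x + 1 = N - (x - 1) by ring, show N - x + 2 = N - (x - 2) by ring]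
  simp only [green_reflect hN]
  ring

/-- The difference `D` of the branches vanishes at `y` and `y + 1`. Its alternating part is killed
by `D(y+2) + 3 D(y+1) + D(y)`, and its linear part `(x - y)/5` gives `(2 + 3)/5 = 1`. This jump is
the unit source at the pole. -/
theorem greenLeft_add_two_sub {N : ℤ} (hN : 0 < N) (y : ℤ) :
    greenLeft N y (y + 2) - greenLeft N (N - y) (N - (y + 2)) = 1 := by
  have hL := alternatingLucas_add_one (y + 1)
  have hR := alternatingLucas_add_one (N - (y + 1))
  rw [add_sub_cancel_right, add_assoc, one_add_one_eq_two] at hL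
  rw [show N - (y + 1) + 1 = N - y by ring, show N - (y + 1) - 1 = N - (y + 2) by ring] at hR
  have hR' : alternatingLucas (N - (y + 2)) =
      -3 * alternatingLucas (N - (y + 1)) - alternatingLucas (N - y) := by linarith
  have h0 := greenLeft_reflect_self N y
  have h1 := greenLeft_reflect_add_one hN y
  simp only [greenLeft] at h0 h1 ⊢
  rw [hL, hR']
  push_cast at h0 h1 ⊢
  linear_combination 3 * h1 + h0

theorem lineLaplacian_green {N : ℤ} (hN : 0 < N) (y x : ℤ) :
    lineLaplacian (green N y) x = if x = y then 1 else 0 := by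
  rcases lt_trichotomy x y with h | rfl | h
  · rw [lineLaplacian_green_of_lt hN h, if_neg h.ne]
  · rw [if_pos rfl]
    -- Of the five values read at the pole, only the one at `x + 2` leaves the left branch.
    have h := lineLaplacian_greenLeft N x x
    have h2 := greenLeft_add_two_sub hN x
    simp only [lineLaplacian] at h ⊢
    rw [green_eq_left hN (by omega : x ≤ x + 1), green_eq_left hN (by omega : x - 1 ≤ x + 1),
      green_eq_left hN (by omega : x - 2 ≤ x + 1), green_eq_left hN (by omega : x + 1 ≤ x + 1),
      green_eq_right hN (by omega : x - 1 ≤ x + 2)]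
    linarith
  · rw [← lineLaplacian_green_reflect hN, lineLaplacian_green_of_lt hN (by omega), if_neg h.ne']

theorem green_boundary {N : ℤ} (hN : 0 < N) {y x : ℤ} (hy : 0 ≤ y) (hx : 0 ≤ x) :
    (if x < 1 then green N y x - green N y (x - 1) else 0) +
      (if x < 2 then green N y x - green N y (x - 2) else 0) =
      if x = 0 then 3 / 10 else if x = 1 then 1 / 5 else 0 := by
  obtain rfl | rfl | h : x = 0 ∨ x = 1 ∨ 2 ≤ x := by omega
  · simp only [zero_sub, Int.reduceNeg, zero_lt_one, zero_lt_two, if_true]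
    rw [green_eq_left hN (by omega), green_eq_left hN (by omega), green_eq_left hN (by omega),
      greenLeft_boundary_zero]
  · norm_num
    rw [green_eq_left hN (by omega), green_eq_left hN (by omega), greenLeft_boundary_one]
  · rw [if_neg (by omega), if_neg (by omega), if_neg (by omega), if_neg (by omega), add_zero]

/-! ### From the line to the finite graph -/

theorem sum_fin_ite_val_eq {n : ℕ} (f : ℤ → ℝ) (z : ℤ) :
    ∑ y : Fin n, (if ((y : ℕ) : ℤ) = z then f (y : ℕ) else 0) =
      if 0 ≤ z ∧ z < n then f z else 0 := by
  split_ifs with h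
  · lift z to ℕ using h.1
    have hz : z < n := by omega
    rw [Finset.sum_eq_single ⟨z, hz⟩]
    · simp
    · intro b _ hb
      rw [if_neg]
      intro h'
      exact hb (Fin.ext (by exact_mod_cast h'))
    · simp
  · refine Finset.sum_eq_zero fun y _ => if_neg ?_
    have := y.2
    omega

/-- The graph is the line with the edges leaving the segment removed; the two brackets are those
edges at the left and right ends. -/
theorem lapMatrix_straightLinearTwoTree_mulVec {n : ℕ} (v : ℤ → ℝ) (x : Fin n) :
    ((straightLinearTwoTree n).lapMatrix ℝ *ᵥ fun i => v (i : ℕ)) x =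
      lineLaplacian v (x : ℕ) -
      ((if ((x : ℕ) : ℤ) < 1 then v (x : ℕ) - v ((x : ℕ) - 1) else 0) +
        (if ((x : ℕ) : ℤ) < 2 then v (x : ℕ) - v ((x : ℕ) - 2) else 0)) -
      ((if (n : ℤ) - 1 - (x : ℕ) < 1 then v (x : ℕ) - v ((x : ℕ) + 1) else 0) +
        (if (n : ℤ) - 1 - (x : ℕ) < 2 then v (x : ℕ) - v ((x : ℕ) + 2) else 0)) := by
  have hx := x.2
  have key : ((straightLinearTwoTree n).lapMatrix ℝ *ᵥ fun i => v (i : ℕ)) x =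
      ∑ y : Fin n, if (straightLinearTwoTree n).Adj x y then v (x : ℕ) - v (y : ℕ) else 0 := by
    rw [SimpleGraph.lapMatrix_mulVec_apply, ← Finset.sum_filter,
      ← SimpleGraph.neighborFinset_eq_filter, Finset.sum_sub_distrib, Finset.sum_const,
      SimpleGraph.card_neighborFinset_eq_degree, nsmul_eq_mul]
  have split : ∀ y : Fin n,
      (if (straightLinearTwoTree n).Adj x y then v (x : ℕ) - v (y : ℕ) else 0) =
      (if ((y : ℕ) : ℤ) = (x : ℕ) - 1 then v (x : ℕ) - v (y : ℕ) else 0) +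
      (if ((y : ℕ) : ℤ) = (x : ℕ) - 2 then v (x : ℕ) - v (y : ℕ) else 0) +
      (if ((y : ℕ) : ℤ) = (x : ℕ) + 1 then v (x : ℕ) - v (y : ℕ) else 0) +
      (if ((y : ℕ) : ℤ) = (x : ℕ) + 2 then v (x : ℕ) - v (y : ℕ) else 0) := by
    intro y
    have hA : (straightLinearTwoTree n).Adj x y ↔ (y : ℕ) = x + 1 ∨ (y : ℕ) = x + 2 ∨
      (x : ℕ) = y + 1 ∨ (x : ℕ) = y + 2 := Iff.rfl
    by_cases h : (straightLinearTwoTree n).Adj x y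
    · rw [if_pos h]
      rw [hA] at h
      split_ifs <;> first | omega | simp
    · rw [if_neg h]
      rw [hA] at h
      split_ifs <;> first | omega | simp
  rw [key, Finset.sum_congr rfl fun y _ => split y]
  simp only [Finset.sum_add_distrib]
  have H := fun z => sum_fin_ite_val_eq (n := n) (fun t => v (x : ℕ) - v t) z
  rw [H, H, H, H, lineLaplacian]
  split_ifs <;> first | omega | ring

theorem lapMatrix_mulVec_green {n : ℕ} (hn : 1 < n) (y x : Fin n) :
    ((straightLinearTwoTree n).lapMatrix ℝ *ᵥ fun i => green (n - 1) (y : ℕ) (i : ℕ)) x =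
      (Pi.single y 1 : Fin n → ℝ) x -
      (if ((x : ℕ) : ℤ) = 0 then 3 / 10 else if ((x : ℕ) : ℤ) = 1 then 1 / 5 else 0) -
      (if (n : ℤ) - 1 - (x : ℕ) = 0 then 3 / 10 else
        if (n : ℤ) - 1 - (x : ℕ) = 1 then 1 / 5 else 0) := by
  have hN : (0 : ℤ) < n - 1 := by omega
  have hx := x.2
  have hy := y.2
  rw [lapMatrix_straightLinearTwoTree_mulVec, green_boundary hN (by omega) (by omega),
    lineLaplacian_green hN,
    -- The right end is the left end of the mirror image.
    ← green_boundary hN (y := n - 1 - (y : ℕ)) (x := n - 1 - (x : ℕ)) (by omega) (by omega),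
    sub_sub _ ((x : ℕ) : ℤ) 1, sub_sub _ ((x : ℕ) : ℤ) 2, green_reflect hN, green_reflect hN,
    green_reflect hN]
  have : (Pi.single y 1 : Fin n → ℝ) x = if ((x : ℕ) : ℤ) = (y : ℕ) then 1 else 0 := by
    simp [Pi.single_apply, Fin.ext_iff]
  rw [this]

theorem isUnitFlowPotential_green {n : ℕ} (hn : 1 < n) (a b : Fin n) :
    IsUnitFlowPotential (straightLinearTwoTree n) a b
      (fun i => green (n - 1) (a : ℕ) (i : ℕ) - green (n - 1) (b : ℕ) (i : ℕ)) := by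
  have h := Matrix.mulVec_sub ((straightLinearTwoTree n).lapMatrix ℝ)
    (fun i => green (n - 1) (a : ℕ) (i : ℕ)) (fun i => green (n - 1) (b : ℕ) (i : ℕ))
  ext x
  refine (congrFun h x).trans ?_
  rw [Pi.sub_apply, lapMatrix_mulVec_green hn, lapMatrix_mulVec_green hn, Pi.sub_apply]
  ring

/-! ### Closed form of the resistance -/

theorem resistanceDistance_straightLinearTwoTree {n k : ℕ} (hn : 1 < n) {a b : Fin n}
    (hab : (b : ℕ) = a + k) :
    resistanceDistance (straightLinearTwoTree n) a b = k / 5 +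
      (halfLucas (n - 1) - (-1) ^ k * halfLucas (n - 1 - k) +
        halfLucas (a + b - (n - 1)) * (halfLucas k - (-1) ^ k)) /
      (5 * boundaryWronskian (n - 1)) := by
  have hN : (0 : ℤ) < n - 1 := by omega
  rw [resistanceDistance_eq (isUnitFlowPotential_green hn a b)]
  have hb : ((b : ℕ) : ℤ) = (a : ℕ) + k := by exact_mod_cast hab
  rw [hb]
  generalize ((a : ℕ) : ℤ) = x
  generalize (n : ℤ) - 1 = N at hN ⊢
  have hk0 : (0 : ℤ) ≤ k := by omega
  -- Symmetry of the Green function reduces all the values needed to left branches.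
  have e1 : green N x (x + k) = green N (x + k) x := by
    rw [green_eq_right hN (by omega), green_eq_left hN (by omega)]
    simp only [greenLeft, alternatingLucas_sub]
    have h : (-1 : ℝ) ^ (N - x) * (-1) ^ N = (-1) ^ x := by
      rw [← zpow_add₀ (by norm_num), show N - x + N = (N - x) + (N - x) + x by ring,
        zpow_add₀ (by norm_num), zpow_add₀ (by norm_num), neg_one_zpow_mul_self, one_mul]
    rw [sub_sub_cancel]
    simp only [alternatingLucas]
    push_cast
    linear_combination halfLucas x / (5 * boundaryWronskian N) * (-1) ^ (x + (k : ℤ)) *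
      halfLucas (N - (x + k)) * h
  rw [e1, green_eq_left hN (by omega), green_eq_left hN (by omega), green_eq_left hN (by omega)]
  simp only [greenLeft, alternatingLucas]
  have s1 := neg_one_zpow_mul_self x
  have s2 := neg_one_zpow_mul_self (x + k)
  have s3 : (-1 : ℝ) ^ (x + k : ℤ) * (-1) ^ x = (-1) ^ k := by
    rw [zpow_add₀ (by norm_num), mul_right_comm, s1, one_mul, zpow_natCast]
  have p1 := halfLucas_mul x (N - x)
  have p2 := halfLucas_mul (x + k) (N - (x + k))
  have p3 := halfLucas_mul x (N - (x + k))
  have p4 := halfLucas_mul (x + (x + k) - N) k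
  rw [show x + (N - x) = N by ring, show x - (N - x) = x + (x + k) - N - k by ring] at p1
  rw [show x + k + (N - (x + k)) = N by ring,
    show x + k - (N - (x + k)) = x + (x + k) - N + k by ring] at p2
  rw [show x + (N - (x + k)) = N - k by ring,
    show x - (N - (x + k)) = x + (x + k) - N by ring] at p3
  push_cast
  linear_combination (1 / (5 * boundaryWronskian N)) *
    (halfLucas x * halfLucas (N - x) * s1 + halfLucas (x + k) * halfLucas (N - (x + k)) * s2
      - 2 * halfLucas x * halfLucas (N - (x + k)) * s3
      + p1 / 2 + p2 / 2 - (-1) ^ k * p3 - p4 / 2)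

/-! ### Comparing resistances -/

theorem one_lt_halfLucas {m : ℤ} (hm : m ≠ 0) : 1 < halfLucas m := by
  rw [← halfLucas_zero, halfLucas_lt_iff, abs_zero]; exact abs_pos.2 hm

/-- In the worst case `h(t) = h(N-k)` and `h(s) = 1`. Then `h(N-k) h(k) = (h(N) + h(N-2k))/2`, while
`W - h(N)/2 = 2 h(N-1) - h(N-2)`; the latter absorbs what remains. The summand `W` is the extra
`1/5` after multiplication by `5W`. -/
theorem resistance_increment_pos {N s t : ℤ} {k : ℕ} (hk : 2 ≤ k) (hkN : (k : ℤ) + 1 ≤ N)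
    (ht : |t| ≤ N - k) :
    (halfLucas N - (-1) ^ k * halfLucas (N - k) + halfLucas t * (halfLucas k - (-1) ^ k)) <
      boundaryWronskian N + (halfLucas N - (-1) ^ (k + 1) * halfLucas (N - (k + 1 : ℕ)) +
        halfLucas s * (halfLucas (k + 1 : ℕ) - (-1) ^ (k + 1))) := by
  have mono : ∀ {x y : ℤ}, |x| ≤ |y| → halfLucas x ≤ halfLucas y := halfLucas_le_iff.2
  have ht' : halfLucas t ≤ halfLucas (N - k) :=
    mono (by rw [abs_of_nonneg (by omega : 0 ≤ N - (k : ℤ))]; exact ht)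
  have hp := halfLucas_mul (N - k) k
  rw [sub_add_cancel, sub_sub, ← two_mul] at hp
  have hs := one_le_halfLucas s
  have hk1 := one_lt_halfLucas (m := (k : ℤ)) (by omega)
  have hk2 := one_lt_halfLucas (m := ((k + 1 : ℕ) : ℤ)) (by omega)
  have r1 := halfLucas_add_one N
  have r2 := halfLucas_add_one (N - 1)
  rw [sub_add_cancel, sub_sub, one_add_one_eq_two] at r2
  have m1 : halfLucas (N - 2 * k) ≤ halfLucas (N - 2) :=
    mono (by rw [abs_of_nonneg (by omega : 0 ≤ N - 2), abs_le]; omega)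
  have m2 : halfLucas (N - 2) ≤ halfLucas (N - 1) :=
    mono (by rw [abs_of_nonneg (by omega), abs_of_nonneg (by omega)]; omega)
  have pos := one_le_halfLucas (N - 2)
  have pos1 := one_le_halfLucas (N - k)
  have pos2 := one_le_halfLucas (N - (k + 1 : ℕ))
  rw [boundaryWronskian]
  rcases Nat.even_or_odd k with he | ho
  · rw [he.neg_one_pow, he.add_one.neg_one_pow]
    have u : halfLucas t * (halfLucas k - 1) ≤ halfLucas (N - k) * (halfLucas k - 1) :=
      mul_le_mul_of_nonneg_right ht' (by linarith)
    have w : 1 * (halfLucas (k + 1 : ℕ) - -1) ≤ halfLucas s * (halfLucas (k + 1 : ℕ) - -1) :=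
      mul_le_mul_of_nonneg_right hs (by linarith)
    linarith
  -- For odd `k` the terms in `h(N-k)` and `h(N-k-1)` have the unfavourable sign. With `k ≥ 3` they
  -- are at most `h(N-3)` and `h(N-4)`, and two more steps of the recurrence dominate them.
  · have hk3 : 3 ≤ k := by
      obtain ⟨c, rfl⟩ := ho
      omega
    rw [ho.neg_one_pow, ho.add_one.neg_one_pow]
    have u : halfLucas t * (halfLucas k - -1) ≤ halfLucas (N - k) * (halfLucas k - -1) :=
      mul_le_mul_of_nonneg_right ht' (by linarith)
    have w : 1 * (halfLucas (k + 1 : ℕ) - 1) ≤ halfLucas s * (halfLucas (k + 1 : ℕ) - 1) :=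
      mul_le_mul_of_nonneg_right hs (by linarith)
    have r3 := halfLucas_add_one (N - 2)
    have r4 := halfLucas_add_one (N - 3)
    rw [show N - 2 + 1 = N - 1 by ring, show N - 2 - 1 = N - 3 by ring] at r3
    rw [show N - 3 + 1 = N - 2 by ring, show N - 3 - 1 = N - 4 by ring] at r4
    have m3 : halfLucas (N - k) ≤ halfLucas (N - 3) :=
      mono (by rw [abs_of_nonneg (by omega), abs_of_nonneg (by omega)]; omega)
    have m4 : halfLucas (N - (k + 1 : ℕ)) ≤ halfLucas (N - 4) :=
      mono (by rw [abs_of_nonneg (by omega), abs_of_nonneg (by omega)]; omega)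
    have m5 : halfLucas (N - 4) ≤ halfLucas (N - 3) :=
      mono (by rw [abs_of_nonneg (by omega), abs_of_nonneg (by omega)]; omega)
    have pos4 := one_le_halfLucas (N - 4)
    linarith

theorem resistanceDistance_lt_of_add_one {n k : ℕ} (hk : 2 ≤ k) {j j' l l' : Fin n}
    (hj : (j' : ℕ) = j + k) (hl : (l' : ℕ) = l + (k + 1)) :
    resistanceDistance (straightLinearTwoTree n) j j' <
      resistanceDistance (straightLinearTwoTree n) l l' := by
  have h1 := j'.2
  have h2 := l'.2
  have hn : 1 < n := by omega
  have hW := boundaryWronskian_pos (N := n - 1) (by omega)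
  rw [resistanceDistance_straightLinearTwoTree hn hj, resistanceDistance_straightLinearTwoTree hn hl]
  have h := resistance_increment_pos (N := n - 1) (s := (l : ℕ) + (l' : ℕ) - (n - 1))
    (t := (j : ℕ) + (j' : ℕ) - (n - 1)) hk (by omega) (by rw [abs_le]; omega)
  have h' := div_lt_div_of_pos_right h (by positivity : 0 < 5 * boundaryWronskian (n - 1))
  rw [add_div (boundaryWronskian _), show boundaryWronskian (n - 1) / (5 * boundaryWronskian (n - 1)) = 1 / 5 by
    field_simp] at h'
  push_cast at h' ⊢
  linarith

theorem resistanceDistance_lt_of_lt {n k m : ℕ} (hk : 2 ≤ k) (hkm : k < m) {a b c d : Fin n}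
    (hab : (b : ℕ) = a + k) (hcd : (d : ℕ) = c + m) :
    resistanceDistance (straightLinearTwoTree n) a b <
      resistanceDistance (straightLinearTwoTree n) c d := by
  induction m, hkm using Nat.le_induction generalizing d with
  | base => exact resistanceDistance_lt_of_add_one hk hab hcd
  | succ m hm ih =>
    have hd := d.2
    -- The intermediate pair keeps the left end `c`; its right end is in range because it precedes
    -- `d`.
    exact (ih (d := ⟨c + m, by omega⟩) rfl).trans
      (resistanceDistance_lt_of_add_one (k := m) (by omega) rfl hcd)

theorem resistanceDistance_lt_iff_of_eq {n k : ℕ} (hk : 0 < k) {a b c d : Fin n}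
    (hab : (b : ℕ) = a + k) (hcd : (d : ℕ) = c + k) :
    resistanceDistance (straightLinearTwoTree n) a b <
      resistanceDistance (straightLinearTwoTree n) c d ↔
    |((a : ℕ) : ℤ) + (b : ℕ) - (n - 1)| < |((c : ℕ) : ℤ) + (d : ℕ) - (n - 1)| := by
  have hb := b.2
  have hn : 1 < n := by omega
  have hW := boundaryWronskian_pos (N := n - 1) (by omega)
  have hk' : 0 < halfLucas k - (-1) ^ k := by
    have h1 := one_lt_halfLucas (m := (k : ℤ)) (by omega)
    rcases neg_one_pow_eq_or ℝ k with h | h <;> rw [h] <;> linarith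
  rw [resistanceDistance_straightLinearTwoTree hn hab,
    resistanceDistance_straightLinearTwoTree hn hcd, add_lt_add_iff_left,
    div_lt_div_iff_of_pos_right (by positivity), add_lt_add_iff_left, mul_lt_mul_iff_left₀ hk',
    halfLucas_lt_iff]

theorem mainTheorem10 (n : ℕ) :
    (∀ k : ℕ, 2 ≤ k → ∀ j j' l l' : Fin n, (j' : ℕ) = j + k → (l' : ℕ) = l + (k + 1) →
      resistanceDistance (straightLinearTwoTree n) j j' <
        resistanceDistance (straightLinearTwoTree n) l l') ∧
    (∀ a b c d : Fin n, a < b → c < d →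
      ¬ (straightLinearTwoTree n).Adj a b → ¬ (straightLinearTwoTree n).Adj c d →
      (resistanceDistance (straightLinearTwoTree n) a b <
          resistanceDistance (straightLinearTwoTree n) c d ↔
        ((b : ℕ) - (a : ℕ) : ℤ) < (d : ℕ) - (c : ℕ) ∨
          ((b : ℕ) - (a : ℕ) : ℤ) = (d : ℕ) - (c : ℕ) ∧
            |((a : ℕ) + 1 : ℤ) + ((b : ℕ) + 1) - (n + 1)| <
              |((c : ℕ) + 1 : ℤ) + ((d : ℕ) + 1) - (n + 1)|) ∧
      (resistanceDistance (straightLinearTwoTree n) a b =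
          resistanceDistance (straightLinearTwoTree n) c d ↔
        (c = a ∧ d = b) ∨ (c = Fin.rev b ∧ d = Fin.rev a))) := by
  refine ⟨fun k hk j j' l l' => resistanceDistance_lt_of_add_one hk, ?_⟩
  intro a b c d hab hcd hab' hcd'
  simp only [straightLinearTwoTree, not_or] at hab' hcd'
  rw [Fin.lt_def] at hab hcd
  -- Here the index distance is `k + 1`, and being a non-edge forces it to be at least 3.
  obtain ⟨k, hk⟩ := Nat.exists_eq_add_of_lt hab
  obtain ⟨m, hm⟩ := Nat.exists_eq_add_of_lt hcd
  have hb := b.2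
  have hd := d.2
  have e : ∀ x y : ℤ, x + 1 + (y + 1) - (n + 1) = x + y - (n - 1) := fun x y => by ring
  simp only [e, Fin.ext_iff, Fin.val_rev]
  rcases lt_trichotomy k m with h | rfl | h
  · have hlt := resistanceDistance_lt_of_lt (k := k + 1) (m := m + 1) (by omega) (by omega) hk hm
    exact ⟨iff_of_true hlt (Or.inl (by omega)), iff_of_false hlt.ne (by omega)⟩
  · have h1 := resistanceDistance_lt_iff_of_eq (k := k + 1) (by omega) hk hm
    have h2 := resistanceDistance_lt_iff_of_eq (k := k + 1) (by omega) hm hk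
    refine ⟨by rw [h1]; omega, ?_⟩
    -- Equal resistance means equal absolute offsets from the centre: equal signs give the same
    -- pair, opposite signs its mirror image.
    rw [le_antisymm_iff, ← not_lt, ← not_lt, h1, h2, not_lt, not_lt, ← le_antisymm_iff, eq_comm,
      abs_eq_abs]
    omega
  · have hlt := resistanceDistance_lt_of_lt (k := m + 1) (m := k + 1) (by omega) (by omega) hm hk
    exact ⟨iff_of_false hlt.not_gt (by omega), iff_of_false hlt.ne' (by omega)⟩
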